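/- **Definitions.** Let $G$ be a countable discrete group and $L<G$ a subgroup. The pair $(G,L)$ has the *Haagerup property from below* if there is a sequence of positive definite functions $\psi_n:G\to\mathbb C$ such that $\lim_{n\to\infty}|1-\psi_n(g)|=0$ for all $g\in G$, and $\psi_n|_L\in C_0(L)$ for all $n$. Let $B$ be a finite von Neumann algebra with a faithful normal tracial state $\tau$, let $\sigma:\Gamma\to\mathrm{Aut}(B)$ be a $\tau$-preserving action of a countable discrete group, and let $N=B\rtimes\Gamma$ be the crossed product, with canonical unitaries $u_\gamma$, canonical trace $\tau$, norm $\|x\|_2=\tau(x^*x)^{1/2}$ and Hilbert space $L^2N$. Let $L^2B\,u_\gamma$ be the closure of $Bu_\gamma$ in $L^2N$, and let $E_B:L^2N\to L^2B$ be the orthogonal projection, which extends the trace preserving conditional expectation $N\to B$. The inclusion $B\subset N$ has the *Haagerup property from below* if there is a sequence of unital completely positive maps $\Psi_n:N\to N$, each of which extends to a bounded operator on $L^2N$ (also denoted $\Psi_n$), such that 1. $\lim_{n\to\infty}\|\Psi_n(x)-x\|_2=0$ for all $x\in N$; 2. $\Psi_n(L^2B\,u_\gamma)\subset L^2B\,u_\gamma$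 for all $n$ and all $\gamma\in\Gamma$; 3. $\xi\mapsto\Psi_n(E_B(\xi u_\gamma^*))$ is a compact operator on $L^2N$ for all $n$ and all $\gamma\in\Gamma$. **Theorem.** Let $\Gamma$ be a countable discrete group which acts by automorphisms on a countable discrete group $\Lambda$. Let $L\Lambda$ be the group von Neumann algebra of $\Lambda$, that is, the von Neumann algebra on $\ell^2(\Lambda)$ generated by the left regular representation, with its canonical trace $\tau(x)=\langle x\delta_e,\delta_e\rangle$, and let $\Gamma$ act on $L\Lambda$ by the induced trace preserving action $\sigma_\gamma(\lambda_g)=\lambda_{\gamma\cdot g}$. Then the pair $(\Lambda\rtimes\Gamma,\Lambda)$ has the Haagerup property from below if and only if the inclusion $L\Lambda\subset L\Lambda\rtimes\Gamma$ has the Haagerup property from below. -/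

import Mathlib

open Filter Topology
open scoped InnerProductSpace ComplexOrder

universe u v w

noncomputable section

/-! ### Positive definite functions and pairs of groups -/

/-- A function `φ : G → ℂ` is positive definite if all matrices `[φ (gᵢ⁻¹ gⱼ)]` are positive
semidefinite. -/
def IsPositiveDefinite {G : Type u} [Group G] (φ : G → ℂ) : Prop :=
  ∀ (n : ℕ) (g : Fin n → G), (Matrix.of fun i j => φ ((g i)⁻¹ * g j)).PosSemidef

/-- The pair `(G, L)` has the Haagerup property from below: there are positive definite functions
on `G` which converge pointwise to `1` and whose restrictions to `L` vanish at infinity. -/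
def GroupHaagerupFromBelow (G : Type u) [Group G] (L : Subgroup G) : Prop :=
  ∃ ψ : ℕ → G → ℂ,
    (∀ n, IsPositiveDefinite (ψ n)) ∧
    (∀ g, Tendsto (fun n => ‖1 - ψ n g‖) atTop (𝓝 0)) ∧
    ∀ n, Tendsto (fun x : L => ψ n x) cofinite (𝓝 0)

/-! ### Von Neumann algebras as C⋆-algebras, and generation -/

namespace VonNeumannAlgebra

variable {H : Type u} [NormedAddCommGroup H] [InnerProductSpace ℂ H] [CompleteSpace H]

instance instSMulMemClass : SMulMemClass (VonNeumannAlgebra H) ℂ (H →L[ℂ] H) where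
  smul_mem {M} c _ hx := M.toStarSubalgebra.smul_mem hx c

instance instIsClosed (M : VonNeumannAlgebra H) : IsClosed (M : Set (H →L[ℂ] H)) := by
  rw [← M.centralizer_centralizer]
  exact Set.isClosed_centralizer _

instance instCStarAlgebra (M : VonNeumannAlgebra H) : CStarAlgebra M :=
  StarSubalgebra.cstarAlgebra M

/-- The usual order of a C⋆-algebra: positive elements are the self-adjoint ones with
nonnegative spectrum. -/
instance instSpectralOrder (M : VonNeumannAlgebra H) : PartialOrder M :=
  CStarAlgebra.spectralOrder M

instance instStarOrderedRing (M : VonNeumannAlgebra H) : StarOrderedRing M :=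
  CStarAlgebra.spectralOrderedRing M

/-- The von Neumann algebra `(S ∪ S⋆)''` generated by a set `S` of operators. -/
def generatedBy (S : Set (H →L[ℂ] H)) : VonNeumannAlgebra H where
  toStarSubalgebra :=
    StarSubalgebra.centralizer ℂ (StarSubalgebra.centralizer ℂ S : Set (H →L[ℂ] H))
  centralizer_centralizer' := by
    have h : ((StarSubalgebra.centralizer ℂ
        (StarSubalgebra.centralizer ℂ S : Set (H →L[ℂ] H))).carrier : Set (H →L[ℂ] H)) =
        Set.centralizer (StarSubalgebra.centralizer ℂ S : Set (H →L[ℂ] H)) := by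
      ext x
      refine ⟨fun hx => fun g hg => ?_, fun hx => ?_⟩
      · exact ((StarSubalgebra.mem_centralizer_iff ℂ).1 hx g hg).1
      · exact (StarSubalgebra.mem_centralizer_iff ℂ).2
          fun g hg => ⟨hx g hg, hx _ (star_mem hg)⟩
    rw [h, Set.centralizer_centralizer_centralizer]

theorem mem_generatedBy {S : Set (H →L[ℂ] H)} {x : H →L[ℂ] H} :
    x ∈ generatedBy S ↔
      ∀ y : H →L[ℂ] H, (∀ s ∈ S, s * y = y * s ∧ star s * y = y * star s) → y * x = x * y := by
  constructor
  · intro hx y hy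
    exact ((StarSubalgebra.mem_centralizer_iff ℂ).1 hx y
      ((StarSubalgebra.mem_centralizer_iff ℂ).2 hy)).1
  · intro h
    refine (StarSubalgebra.mem_centralizer_iff ℂ).2 fun g hg => ?_
    have hg' : star g ∈ StarSubalgebra.centralizer ℂ S := star_mem hg
    exact ⟨h g ((StarSubalgebra.mem_centralizer_iff ℂ).1 hg),
      h _ ((StarSubalgebra.mem_centralizer_iff ℂ).1 hg')⟩

theorem subset_generatedBy {S : Set (H →L[ℂ] H)} {x : H →L[ℂ] H} (hx : x ∈ S) :
    x ∈ generatedBy S :=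
  mem_generatedBy.2 fun _ hy => ((hy x hx).1).symm

end VonNeumannAlgebra

/-! ### Finite von Neumann algebras with a faithful normal trace -/

/-- A finite von Neumann algebra `M` with a faithful normal tracial state `τ`, in its standard
representation on `H = L²(M, τ)`. The vector `Ω` is the image of `1 ∈ M` in `L²(M, τ)`, so that
`x ↦ x Ω` is the inclusion of `M` in `L²(M, τ)` and `τ x = ⟪Ω, x Ω⟫`. (As `Ω` is cyclic and
tracial, it is separating, so `τ` is faithful.) -/
structure TracialVNA (H : Type u) [NormedAddCommGroup H] [InnerProductSpace ℂ H]
    [CompleteSpace H] where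
  alg : VonNeumannAlgebra H
  Ω : H
  norm_Ω : ‖Ω‖ = 1
  tracial : ∀ a ∈ alg, ∀ b ∈ alg, ⟪Ω, a (b Ω)⟫_ℂ = ⟪Ω, b (a Ω)⟫_ℂ
  cyclic : Dense {ξ : H | ∃ a ∈ alg, a Ω = ξ}

namespace TracialVNA

variable {H : Type u} [NormedAddCommGroup H] [InnerProductSpace ℂ H] [CompleteSpace H]

/-- The trace. -/
def τ (B : TracialVNA H) (b : B.alg) : ℂ := ⟪B.Ω, (b : H →L[ℂ] H) B.Ω⟫_ℂ

end TracialVNA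

/-- A trace preserving action of a group on a finite von Neumann algebra. -/
structure TracePreservingAction (Γ : Type v) [Group Γ] {H : Type u} [NormedAddCommGroup H]
    [InnerProductSpace ℂ H] [CompleteSpace H] (B : TracialVNA H) where
  toHom : Γ →* (B.alg ≃⋆ₐ[ℂ] B.alg)
  trace_map : ∀ γ b, B.τ (toHom γ b) = B.τ b

/-! ### Permutation operators on `ℓ²` -/

/-- The unitary `ℓ²(ι, E) → ℓ²(κ, E)` induced by a bijection `e : ι ≃ κ`,
`(V ξ) k = ξ (e⁻¹ k)`. -/
def l2Reindex {ι : Type u} {κ : Type v} (E : Type w) [NormedAddCommGroup E]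
    [InnerProductSpace ℂ E] (e : ι ≃ κ) :
    lp (fun _ : ι => E) 2 ≃ₗᵢ[ℂ] lp (fun _ : κ => E) 2 where
  toFun ξ := ⟨fun k => ξ (e.symm k), memℓp_gen <|
    (Equiv.summable_iff e.symm).2 ((lp.memℓp ξ).summable (by norm_num))⟩
  invFun ξ := ⟨fun i => ξ (e i), memℓp_gen <|
    (Equiv.summable_iff e).2 ((lp.memℓp ξ).summable (by norm_num))⟩
  left_inv ξ := by ext i; simp
  right_inv ξ := by ext i; simp
  map_add' _ _ := rfl
  map_smul' _ _ := rfl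
  norm_map' ξ := by
    rw [lp.norm_eq_tsum_rpow (by norm_num), lp.norm_eq_tsum_rpow (by norm_num)]
    congr 1
    exact Equiv.tsum_eq e.symm fun i => ‖ξ i‖ ^ (2 : ENNReal).toReal

@[simp]
theorem l2Reindex_apply {ι : Type u} {κ : Type v} (E : Type w) [NormedAddCommGroup E]
    [InnerProductSpace ℂ E] (e : ι ≃ κ) (ξ : lp (fun _ : ι => E) 2) (k : κ) :
    l2Reindex E e ξ k = ξ (e.symm k) := rfl

@[simp]
theorem l2Reindex_symm_apply {ι : Type u} {κ : Type v} (E : Type w) [NormedAddCommGroup E]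
    [InnerProductSpace ℂ E] (e : ι ≃ κ) (ξ : lp (fun _ : κ => E) 2) (i : ι) :
    (l2Reindex E e).symm ξ i = ξ (e i) := rfl

/-! ### Crossed products -/

namespace TracePreservingAction

variable {Γ : Type v} [Group Γ] {H : Type u} [NormedAddCommGroup H] [InnerProductSpace ℂ H]
  [CompleteSpace H] {B : TracialVNA H} (σ : TracePreservingAction Γ B)

/-- The representation of `B` on `ℓ²(Γ, H)`: `(b ξ) γ = σ_{γ⁻¹}(b) (ξ γ)`. -/
def embed (b : B.alg) : lp (fun _ : Γ => H) 2 →L[ℂ] lp (fun _ : Γ => H) 2 :=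
  lp.mapCLM 2 (fun γ => ((σ.toHom γ⁻¹ b : B.alg) : H →L[ℂ] H)) (norm_nonneg b)
    fun γ => NonUnitalStarAlgHom.norm_apply_le (σ.toHom γ⁻¹) b

/-- The canonical unitaries `u_γ` on `ℓ²(Γ, H)`: `(u_γ ξ) δ = ξ (γ⁻¹ δ)`. -/
def u (_σ : TracePreservingAction Γ B) (γ : Γ) :
    lp (fun _ : Γ => H) 2 →L[ℂ] lp (fun _ : Γ => H) 2 :=
  (l2Reindex H (Equiv.mulLeft γ)).toContinuousLinearEquiv.toContinuousLinearMap

/-- The crossed product `N = B ⋊ Γ`, the von Neumann algebra generated by `B` and the `u_γ`. -/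
def crossedProduct : VonNeumannAlgebra (lp (fun _ : Γ => H) 2) :=
  VonNeumannAlgebra.generatedBy (Set.range σ.embed ∪ Set.range σ.u)

open Classical in
/-- The vector `δ_e ⊗ Ω`. The canonical trace of `N` is `τ x = ⟪Ω_N, x Ω_N⟫`, and `x ↦ x Ω_N` is
the inclusion of `N` in `L²(N, τ) = ℓ²(Γ, L²(B, τ))`; in particular `‖x‖₂ = ‖x Ω_N‖`. -/
def vacuum (_σ : TracePreservingAction Γ B) : lp (fun _ : Γ => H) 2 := lp.single 2 1 B.Ω

/-- The closed subspace `L²B u_γ` of `L²N`. -/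
def l2Coset (γ : Γ) : Submodule ℂ (lp (fun _ : Γ => H) 2) :=
  (Submodule.span ℂ (Set.range fun b : B.alg => σ.embed b (σ.u γ σ.vacuum))).topologicalClosure

/-- The conditional expectation `E_B` on `L²N`: the orthogonal projection onto `L²B`. -/
def condExp : lp (fun _ : Γ => H) 2 →L[ℂ] lp (fun _ : Γ => H) 2 :=
  haveI : CompleteSpace (σ.l2Coset 1) :=
    (Submodule.isClosed_topologicalClosure _).completeSpace_coe
  (σ.l2Coset 1).starProjection

/-- The inclusion `B ⊂ N = B ⋊ Γ` has the Haagerup property from below: there are unital completely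
positive maps `Ψ n : N → N`, with bounded extensions `T n` to `L²N`, such that
`‖Ψ n x - x‖₂ → 0` for all `x`, every `L²B u_γ` is invariant, and `ξ ↦ Ψ n (E_B (ξ u_γ⋆))` is
a compact operator on `L²N` for every `γ`. The last operator is determined by its values on the
dense subspace `N` of `L²N`. -/
def HaagerupFromBelow : Prop :=
  ∃ (Ψ : ℕ → CompletelyPositiveMap σ.crossedProduct σ.crossedProduct)
    (T : ℕ → lp (fun _ : Γ => H) 2 →L[ℂ] lp (fun _ : Γ => H) 2),
    (∀ n, Ψ n 1 = 1) ∧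
    (∀ n (x : σ.crossedProduct),
      T n ((x : lp (fun _ : Γ => H) 2 →L[ℂ] lp (fun _ : Γ => H) 2) σ.vacuum) =
        (Ψ n x : lp (fun _ : Γ => H) 2 →L[ℂ] lp (fun _ : Γ => H) 2) σ.vacuum) ∧
    (∀ x : σ.crossedProduct, Tendsto (fun n =>
      ‖((Ψ n x - x : σ.crossedProduct) : lp (fun _ : Γ => H) 2 →L[ℂ] lp (fun _ : Γ => H) 2)
        σ.vacuum‖) atTop (𝓝 0)) ∧
    (∀ n γ, ∀ ξ ∈ σ.l2Coset γ, T n ξ ∈ σ.l2Coset γ) ∧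
    (∀ n γ, ∃ K : lp (fun _ : Γ => H) 2 →L[ℂ] lp (fun _ : Γ => H) 2, IsCompactOperator K ∧
      ∀ x : σ.crossedProduct,
        K ((x : lp (fun _ : Γ => H) 2 →L[ℂ] lp (fun _ : Γ => H) 2) σ.vacuum) =
          T n (σ.condExp ((x : lp (fun _ : Γ => H) 2 →L[ℂ] lp (fun _ : Γ => H) 2)
            (star (σ.u γ) σ.vacuum))))

end TracePreservingAction

/-! ### Group von Neumann algebras -/

namespace GroupVNA

variable {Λ : Type u} [Group Λ]

/-- The left regular representation on `ℓ²(Λ)`: `(λ_g ξ) x = ξ (g⁻¹ x)`. -/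
def leftReg (g : Λ) : lp (fun _ : Λ => ℂ) 2 →L[ℂ] lp (fun _ : Λ => ℂ) 2 :=
  (l2Reindex ℂ (Equiv.mulLeft g)).toContinuousLinearEquiv.toContinuousLinearMap

/-- The right regular representation on `ℓ²(Λ)`: `(ρ_g ξ) x = ξ (x g)`. -/
def rightReg (g : Λ) : lp (fun _ : Λ => ℂ) 2 →L[ℂ] lp (fun _ : Λ => ℂ) 2 :=
  (l2Reindex ℂ (Equiv.mulRight g⁻¹)).toContinuousLinearEquiv.toContinuousLinearMap

open Classical in
/-- The vector `δ_e`. -/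
def δ : lp (fun _ : Λ => ℂ) 2 := lp.single 2 (1 : Λ) (1 : ℂ)

variable (Λ) in
/-- The von Neumann algebra of operators on `ℓ²(Λ)` generated by the left regular representation. -/
def alg : VonNeumannAlgebra (lp (fun _ : Λ => ℂ) 2) :=
  VonNeumannAlgebra.generatedBy (Set.range leftReg)

theorem leftReg_apply (g : Λ) (ξ : lp (fun _ : Λ => ℂ) 2) (x : Λ) :
    leftReg g ξ x = ξ (g⁻¹ * x) := by
  simp [leftReg]

theorem rightReg_apply (g : Λ) (ξ : lp (fun _ : Λ => ℂ) 2) (x : Λ) :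
    rightReg g ξ x = ξ (x * g) := by
  simp [rightReg]

theorem δ_apply_one : (δ : lp (fun _ : Λ => ℂ) 2) 1 = 1 := by
  classical
  simp [δ, lp.single_apply]

theorem δ_apply_of_ne {x : Λ} (hx : x ≠ 1) : (δ : lp (fun _ : Λ => ℂ) 2) x = 0 := by
  classical
  simp [δ, lp.single_apply, hx]

theorem inner_δ (ξ : lp (fun _ : Λ => ℂ) 2) : ⟪δ, ξ⟫_ℂ = ξ 1 := by
  classical
  rw [δ, lp.inner_single_left]
  simp

theorem star_leftReg (g : Λ) : star (leftReg g) = leftReg g⁻¹ := by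
  rw [ContinuousLinearMap.star_eq_adjoint, leftReg]
  refine (LinearIsometryEquiv.adjoint_eq_symm (l2Reindex ℂ (Equiv.mulLeft g))).trans ?_
  ext ξ x
  simp [leftReg]

theorem star_rightReg (g : Λ) : star (rightReg g) = rightReg g⁻¹ := by
  rw [ContinuousLinearMap.star_eq_adjoint, rightReg]
  refine (LinearIsometryEquiv.adjoint_eq_symm (l2Reindex ℂ (Equiv.mulRight g⁻¹))).trans ?_
  ext ξ x
  simp [rightReg]

theorem leftReg_mul_rightReg (g h : Λ) : leftReg g * rightReg h = rightReg h * leftReg g := by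
  ext ξ x
  simp [leftReg_apply, rightReg_apply, mul_assoc]

theorem mul_rightReg {a : lp (fun _ : Λ => ℂ) 2 →L[ℂ] lp (fun _ : Λ => ℂ) 2} (ha : a ∈ alg Λ)
    (g : Λ) : rightReg g * a = a * rightReg g := by
  refine VonNeumannAlgebra.mem_generatedBy.1 ha _ ?_
  rintro _ ⟨h, rfl⟩
  exact ⟨leftReg_mul_rightReg h g, by rw [star_leftReg]; exact leftReg_mul_rightReg _ g⟩

theorem star_apply_δ {a : lp (fun _ : Λ => ℂ) 2 →L[ℂ] lp (fun _ : Λ => ℂ) 2} (ha : a ∈ alg Λ)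
    (x : Λ) : (star a δ) x = star ((a δ) x⁻¹) := by
  have h1 : (star a δ) x = ⟪δ, rightReg x (star a δ)⟫_ℂ := by
    rw [inner_δ, rightReg_apply, one_mul]
  have h2 : rightReg x (star a δ) = star a (rightReg x δ) :=
    DFunLike.congr_fun (mul_rightReg (star_mem ha) x) δ
  have h3 : rightReg x⁻¹ (a δ) = a (rightReg x⁻¹ δ) :=
    DFunLike.congr_fun (mul_rightReg ha x⁻¹) δ
  rw [h1, h2, ContinuousLinearMap.star_eq_adjoint, ContinuousLinearMap.adjoint_inner_right,
    ← inv_inv x, ← star_rightReg, ContinuousLinearMap.star_eq_adjoint,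
    ContinuousLinearMap.adjoint_inner_right, ← inner_conj_symm, inner_δ, rightReg_apply, one_mul,
    inv_inv]
  rfl

theorem inner_δ_mul {a b : lp (fun _ : Λ => ℂ) 2 →L[ℂ] lp (fun _ : Λ => ℂ) 2} (ha : a ∈ alg Λ) :
    ⟪δ, a (b δ)⟫_ℂ = ∑' x : Λ, (a δ) x⁻¹ * (b δ) x := by
  rw [← ContinuousLinearMap.adjoint_inner_left, ← ContinuousLinearMap.star_eq_adjoint,
    lp.inner_eq_tsum]
  refine tsum_congr fun x => ?_
  rw [star_apply_δ ha]
  simp [mul_comm]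

variable (Λ) in
/-- The group von Neumann algebra `LΛ` on `L²(LΛ) = ℓ²(Λ)`, with its canonical trace
`τ x = ⟪δ_e, x δ_e⟫`. -/
def tracial : TracialVNA (lp (fun _ : Λ => ℂ) 2) where
  alg := alg Λ
  Ω := δ
  norm_Ω := by
    classical
    rw [δ, lp.norm_single (by norm_num)]
    simp
  tracial a ha b hb := by
    rw [inner_δ_mul ha, inner_δ_mul hb, ← Equiv.tsum_eq (Equiv.inv Λ)]
    refine tsum_congr fun x => ?_
    simp [mul_comm]
  cyclic := by
    classical
    let S : Submodule ℂ (lp (fun _ : Λ => ℂ) 2) :=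
      { carrier := {ξ | ∃ a ∈ alg Λ, a δ = ξ}
        add_mem' := by
          rintro _ _ ⟨a, ha, rfl⟩ ⟨b, hb, rfl⟩
          exact ⟨a + b, add_mem ha hb, rfl⟩
        zero_mem' := ⟨0, zero_mem _, rfl⟩
        smul_mem' := by
          rintro c _ ⟨a, ha, rfl⟩
          exact ⟨c • a, SMulMemClass.smul_mem c ha, rfl⟩ }
    intro ξ
    refine mem_closure_of_tendsto (lp.hasSum_single (by norm_num) ξ)
      (Eventually.of_forall fun s => ?_)
    change _ ∈ S
    refine sum_mem fun g _ => ?_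
    have hg : lp.single 2 g (ξ g) = ξ g • leftReg g δ := by
      ext x
      by_cases hx : x = g
      · subst hx
        simp [leftReg_apply, δ_apply_one]
      · have hx' : g⁻¹ * x ≠ 1 := fun h => hx (inv_mul_eq_one.1 h).symm
        simp [leftReg_apply, δ_apply_of_ne hx', lp.single_apply, hx]
    rw [hg]
    exact S.smul_mem _ ⟨leftReg g, VonNeumannAlgebra.subset_generatedBy ⟨g, rfl⟩, rfl⟩

/-- The unitary on `ℓ²(Λ)` induced by an automorphism of `Λ`, `δ_g ↦ δ_{θ g}`. -/
def autUnitary (θ : MulAut Λ) : lp (fun _ : Λ => ℂ) 2 ≃ₗᵢ[ℂ] lp (fun _ : Λ => ℂ) 2 :=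
  l2Reindex ℂ θ.toEquiv

theorem autUnitary_apply (θ : MulAut Λ) (ξ : lp (fun _ : Λ => ℂ) 2) (x : Λ) :
    autUnitary θ ξ x = ξ (θ⁻¹ x) := rfl

theorem autUnitary_mul (θ η : MulAut Λ) (ξ : lp (fun _ : Λ => ℂ) 2) :
    autUnitary (θ * η) ξ = autUnitary θ (autUnitary η ξ) := by
  ext x
  rfl

theorem autUnitary_symm (θ : MulAut Λ) : (autUnitary θ).symm = autUnitary θ⁻¹ := by
  ext ξ x
  rfl

theorem autUnitary_δ (θ : MulAut Λ) : autUnitary θ δ = δ := by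
  ext x
  rw [autUnitary_apply]
  by_cases hx : x = 1
  · simp [hx]
  · rw [δ_apply_of_ne hx, δ_apply_of_ne]
    simpa using hx

theorem conj_leftReg (θ : MulAut Λ) (g : Λ) :
    (autUnitary θ).conjStarAlgEquiv (leftReg g) = leftReg (θ g) := by
  ext ξ x
  simp [autUnitary_symm, autUnitary_apply, leftReg_apply]

theorem conj_mul (θ η : MulAut Λ) (a : lp (fun _ : Λ => ℂ) 2 →L[ℂ] lp (fun _ : Λ => ℂ) 2) :
    (autUnitary (θ * η)).conjStarAlgEquiv a =
      (autUnitary θ).conjStarAlgEquiv ((autUnitary η).conjStarAlgEquiv a) := by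
  ext ξ x
  simp [autUnitary_symm, autUnitary_mul]

theorem conj_one (a : lp (fun _ : Λ => ℂ) 2 →L[ℂ] lp (fun _ : Λ => ℂ) 2) :
    (autUnitary (1 : MulAut Λ)).conjStarAlgEquiv a = a := by
  ext ξ x
  rfl

theorem conj_mem (θ : MulAut Λ) {a : lp (fun _ : Λ => ℂ) 2 →L[ℂ] lp (fun _ : Λ => ℂ) 2}
    (ha : a ∈ alg Λ) : (autUnitary θ).conjStarAlgEquiv a ∈ alg Λ := by
  refine VonNeumannAlgebra.mem_generatedBy.2 fun y hy => ?_
  have hy' : ∀ s ∈ Set.range (leftReg (Λ := Λ)),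
      s * (autUnitary θ⁻¹).conjStarAlgEquiv y = (autUnitary θ⁻¹).conjStarAlgEquiv y * s ∧
      star s * (autUnitary θ⁻¹).conjStarAlgEquiv y =
        (autUnitary θ⁻¹).conjStarAlgEquiv y * star s := by
    have key : ∀ g : Λ, leftReg g * (autUnitary θ⁻¹).conjStarAlgEquiv y =
        (autUnitary θ⁻¹).conjStarAlgEquiv y * leftReg g := by
      intro g
      have h := congrArg (autUnitary θ⁻¹).conjStarAlgEquiv (hy (leftReg (θ g)) ⟨_, rfl⟩).1
      rw [map_mul, map_mul, conj_leftReg] at h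
      simpa using h
    rintro _ ⟨g, rfl⟩
    exact ⟨key g, by rw [star_leftReg]; exact key _⟩
  have h := congrArg (autUnitary θ).conjStarAlgEquiv
    (VonNeumannAlgebra.mem_generatedBy.1 ha _ hy')
  rwa [map_mul, map_mul, ← conj_mul, mul_inv_cancel, conj_one] at h

/-- The automorphism of `LΛ` induced by an automorphism `θ` of `Λ`, `λ_g ↦ λ_{θ g}`. -/
def autAlg (θ : MulAut Λ) : alg Λ ≃⋆ₐ[ℂ] alg Λ where
  toFun a := ⟨(autUnitary θ).conjStarAlgEquiv a, conj_mem θ a.2⟩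
  invFun a := ⟨(autUnitary θ⁻¹).conjStarAlgEquiv a, conj_mem θ⁻¹ a.2⟩
  left_inv a := Subtype.ext (by
    change (autUnitary θ⁻¹).conjStarAlgEquiv ((autUnitary θ).conjStarAlgEquiv a) = a
    rw [← conj_mul, inv_mul_cancel, conj_one])
  right_inv a := Subtype.ext (by
    change (autUnitary θ).conjStarAlgEquiv ((autUnitary θ⁻¹).conjStarAlgEquiv a) = a
    rw [← conj_mul, mul_inv_cancel, conj_one])
  map_mul' a b := Subtype.ext (map_mul (autUnitary θ).conjStarAlgEquiv a.1 b.1)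
  map_add' a b := Subtype.ext (map_add (autUnitary θ).conjStarAlgEquiv a.1 b.1)
  map_star' a := Subtype.ext (map_star (autUnitary θ).conjStarAlgEquiv a.1)
  map_smul' c a := Subtype.ext (map_smul (autUnitary θ).conjStarAlgEquiv c a.1)

/-- The trace preserving action of `Γ` on `LΛ` induced by an action of `Γ` on `Λ`. -/
def action {Γ : Type v} [Group Γ] (α : Γ →* MulAut Λ) :
    TracePreservingAction Γ (tracial Λ) where
  toHom :=
    { toFun := fun γ => autAlg (α γ)
      map_one' := by
        rw [map_one]
        ext a : 2
        exact conj_one _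
      map_mul' := fun γ γ' => by
        rw [map_mul]
        ext a : 2
        exact conj_mul _ _ _ }
  trace_map γ b := by
    change ⟪δ, autUnitary (α γ) (b.1 ((autUnitary (α γ)).symm δ))⟫_ℂ =
      ⟪δ, b.1 δ⟫_ℂ
    rw [autUnitary_symm, autUnitary_δ, inner_δ, inner_δ, autUnitary_apply, map_one]

end GroupVNA

end

/-! Put G = Λ ⋊ Γ. The vectors λ_g u_γ Ω form an orthonormal basis (e_s) of L²(LΛ ⋊ Γ) indexed by G
(`crossedBasis`). The crossed product is the set of all operators whose matrix in this basis is
invariant under right translation (`mem_crossedProduct`), so LΛ ⋊ Γ = LG. The space L²B u_γ consists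
of the vectors supported on the coset Λγ, and E_B cuts down to Λ. What remains is the correspondence
between positive definite functions on G and completely positive maps of LG.

From groups to algebras: normalise φ to φ(1) = 1 and write φ(st⁻¹) = ⟪v_s, v_t⟫. With the isometry V
: e_s ↦ v_s ⊗ e_s, the map x ↦ V*(x ⊗ 1)V is unital, completely positive and multiplies the (s,t)
entry of x by φ(st⁻¹) (`IsPositiveDefinite.exists_multiplier`). On L² it is diagonal with
coefficients φ, so it preserves every coset and tends strongly to the identity by dominated
convergence. Composed with E_B, its coefficients vanish at infinity, which makes it compact
(`HilbertBasis.isCompactOperator_diagonal`).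

From algebras to groups: put ψ(s) = ⟪e_s, Ψ(λ_s) Ω⟫. The matrix (λ_{g_i⁻¹ g_j}) is positive, so
complete positivity makes ψ positive definite (`CompletelyPositiveMap.isPositiveDefinite`). The
distance from ψ(s) to 1 is at most ‖Ψ(λ_s) - λ_s‖₂. On Λ, ψ(s) is a diagonal coefficient ⟪e_s, K
e_s⟫ of a compact operator and so tends to 0 (`IsCompactOperator.tendsto_inner_orthonormal`). -/

noncomputable section

/-! ### Compact and diagonal operators -/

section Compact

variable {H : Type*} [NormedAddCommGroup H] [InnerProductSpace ℂ H]

/-- Bessel's inequality: the squared coefficients are summable. -/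
theorem Orthonormal.tendsto_inner_cofinite {ι : Type*} {v : ι → H} (hv : Orthonormal ℂ v) (x : H) :
    Tendsto (fun i => ⟪x, v i⟫_ℂ) cofinite (𝓝 0) := by
  have h := (hv.inner_products_summable x).tendsto_cofinite_zero
  rw [tendsto_zero_iff_norm_tendsto_zero]
  have h2 := h.sqrt
  simpa [norm_inner_symm] using h2

/-- A compact operator maps orthonormal families to families vanishing at infinity. -/
theorem IsCompactOperator.tendsto_orthonormal [CompleteSpace H] {ι : Type*} {v : ι → H} (hv : Orthonormal ℂ v)
    {K : H →L[ℂ] H} (hK : IsCompactOperator K) :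
    Tendsto (fun i => K (v i)) cofinite (𝓝 0) := by
  obtain ⟨S, hS, hKS⟩ := hK.image_closedBall_subset_compact (f := (K : H →ₗ[ℂ] H)) 1
  -- All values lie in a compact set, so it suffices that 0 is the only cluster point. This follows
  -- from weak convergence to 0, obtained by moving `K` to the other side as its adjoint.
  refine hS.tendsto_nhds_of_unique_mapClusterPt (Eventually.of_forall fun i => hKS ?_) ?_
  · exact ⟨v i, by simp [hv.1 i], rfl⟩
  · intro y _ hy
    refine ext_inner_left ℂ fun z => ?_
    have h1 : MapClusterPt ⟪z, y⟫_ℂ cofinite fun i => ⟪z, K (v i)⟫_ℂ :=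
      hy.continuousAt_comp (f := fun y => ⟪z, y⟫_ℂ) (Continuous.continuousAt (by fun_prop))
    have h2 : Tendsto (fun i => ⟪z, K (v i)⟫_ℂ) cofinite (𝓝 0) := by
      simpa [ContinuousLinearMap.adjoint_inner_left] using
        hv.tendsto_inner_cofinite (ContinuousLinearMap.adjoint K z)
    rw [inner_zero_right]
    exact eq_of_nhds_neBot (h1.neBot.mono (inf_le_inf_left _ h2))

end Compact

namespace HilbertBasis

variable {ι : Type*} {H : Type*} [NormedAddCommGroup H] [InnerProductSpace ℂ H]
  (e : HilbertBasis ι ℂ H)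

theorem ext_inner {x y : H} (h : ∀ i, ⟪e i, x⟫_ℂ = ⟪e i, y⟫_ℂ) : x = y := by
  apply e.repr.injective
  ext i
  simpa [e.repr_apply_apply] using h i

theorem inner_eq_ite [DecidableEq ι] (i j : ι) : ⟪e i, e j⟫_ℂ = if i = j then 1 else 0 :=
  orthonormal_iff_ite.1 e.orthonormal i j

theorem ext_operator {A B : H →L[ℂ] H} (h : ∀ i, A (e i) = B (e i)) : A = B := by
  refine ContinuousLinearMap.ext_on (s := Set.range e) ?_ (by rintro _ ⟨i, rfl⟩; exact h i)
  rw [Submodule.dense_iff_topologicalClosure_eq_top]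
  exact e.dense_span

theorem ext_matrix {A B : H →L[ℂ] H} (h : ∀ i j, ⟪e i, A (e j)⟫_ℂ = ⟪e i, B (e j)⟫_ℂ) : A = B :=
  e.ext_operator fun j => e.ext_inner fun i => h i j

/-- Parseval's identity for A* e_i and B e_j. -/
theorem hasSum_matrix_mul [CompleteSpace H] (A B : H →L[ℂ] H) (i j : ι) :
    HasSum (fun k => ⟪e i, A (e k)⟫_ℂ * ⟪e k, B (e j)⟫_ℂ) ⟪e i, A (B (e j))⟫_ℂ := by
  have := e.hasSum_inner_mul_inner (ContinuousLinearMap.adjoint A (e i)) (B (e j))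
  simpa [ContinuousLinearMap.adjoint_inner_left] using this

theorem hasSum_norm_sq (x : H) : HasSum (fun i => ‖⟪e i, x⟫_ℂ‖ ^ 2) (‖x‖ ^ 2) := by
  have h := lp.hasSum_norm (p := 2) (by norm_num) (e.repr x)
  simpa [e.repr_apply_apply] using h

/-- The operator which is diagonal with respect to a Hilbert basis. -/
def diagonal (c : ι → ℂ) (C : ℝ) (hC : 0 ≤ C) (hc : ∀ i, ‖c i‖ ≤ C) : H →L[ℂ] H :=
  (e.repr.symm.toContinuousLinearEquiv : _ →L[ℂ] H) ∘L
    (lp.mapCLM 2 (fun i => c i • ContinuousLinearMap.id ℂ ℂ) hC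
      fun i => by simpa [norm_smul] using hc i) ∘L
    (e.repr.toContinuousLinearEquiv : H →L[ℂ] _)

variable {c : ι → ℂ} {C : ℝ} (hC : 0 ≤ C) (hc : ∀ i, ‖c i‖ ≤ C)

theorem inner_diagonal (x : H) (i : ι) :
    ⟪e i, e.diagonal c C hC hc x⟫_ℂ = c i * ⟪e i, x⟫_ℂ := by
  rw [← e.repr_apply_apply, ← e.repr_apply_apply]
  simp [diagonal]

theorem diagonal_apply_basis (i : ι) : e.diagonal c C hC hc (e i) = c i • e i := by
  classical
  refine e.ext_inner fun j => ?_
  rw [inner_diagonal, inner_smul_right, inner_eq_ite]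
  split_ifs with h
  · rw [h]
  · simp

theorem norm_diagonal_le : ‖e.diagonal c C hC hc‖ ≤ C := by
  refine ContinuousLinearMap.opNorm_le_bound _ hC fun x => ?_
  refine abs_le_of_sq_le_sq' ?_ (by positivity) |>.2
  refine hasSum_le (fun i => ?_) (e.hasSum_norm_sq _)
    (mul_pow C ‖x‖ 2 ▸ (e.hasSum_norm_sq x).mul_left (C ^ 2))
  rw [inner_diagonal, norm_mul, mul_pow]
  gcongr
  exact hc i

/-- Finite truncations have finite rank, and the remainder is again diagonal with small
coefficients, hence small in operator norm. -/
theorem isCompactOperator_diagonal [CompleteSpace H] (h0 : Tendsto c cofinite (𝓝 0)) :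
    IsCompactOperator (e.diagonal c C hC hc) := by
  classical
  let F : Finset ι → H →L[ℂ] H := fun s => ∑ i ∈ s, c i • InnerProductSpace.rankOne ℂ (e i) (e i)
  refine isCompactOperator_of_tendsto (l := atTop) (F := F) ?_ (Eventually.of_forall fun s => ?_)
  · rw [Metric.tendsto_atTop]
    intro ε hε
    have hfin : {i | ¬ ‖c i‖ < ε / 2}.Finite :=
      (tendsto_zero_iff_norm_tendsto_zero.1 h0).eventually (gt_mem_nhds (half_pos hε))
    refine ⟨hfin.toFinset, fun s hs => ?_⟩
    have hs' : ∀ i, ‖if i ∈ s then 0 else c i‖ ≤ ε / 2 := by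
      intro i
      split_ifs with hi
      · simpa using (half_pos hε).le
      · by_contra! h
        exact hi (hs (by simpa using h.le))
    have key : e.diagonal c C hC hc - F s = e.diagonal _ (ε / 2) (half_pos hε).le hs' := by
      refine e.ext_operator fun i => ?_
      simp only [sub_apply, diagonal_apply_basis, F,
        sum_apply, smul_apply,
        InnerProductSpace.rankOne_apply, inner_eq_ite]
      by_cases hi : i ∈ s <;> simp [hi]
    rw [dist_comm, dist_eq_norm, key]
    exact (e.norm_diagonal_le _ _).trans_lt (half_lt_self hε)
  · refine Submodule.sum_mem (compactOperator (RingHom.id ℂ) H H) fun i _ => ?_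
    refine Submodule.smul_mem _ _ ?_
    exact (isCompactOperator_of_locallyCompactSpace_rng
      (ContinuousLinearMap.toSpanSingleton ℂ (e i))).comp_clm (innerSL ℂ (e i))

end HilbertBasis

theorem HilbertBasis.isCompactOperator_diagonal_comp {ι H : Type*} [NormedAddCommGroup H]
    [InnerProductSpace ℂ H] [CompleteSpace H] (e : HilbertBasis ι ℂ H) {c : ι → ℂ} {C : ℝ}
    (hC : 0 ≤ C) (hc : ∀ i, ‖c i‖ ≤ C) (h0 : Tendsto c cofinite (𝓝 0)) (R : H →L[ℂ] H) :
    IsCompactOperator (e.diagonal c C hC hc ∘L R) :=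
  (e.isCompactOperator_diagonal hC hc h0).comp_clm R

theorem Orthonormal.norm_one_sub_inner_le {ι H : Type*} [NormedAddCommGroup H]
    [InnerProductSpace ℂ H] {v : ι → H} (hv : Orthonormal ℂ v) (i : ι) (x : H) :
    ‖1 - ⟪v i, x⟫_ℂ‖ ≤ ‖x - v i‖ := by
  have h : 1 - ⟪v i, x⟫_ℂ = -⟪v i, x - v i⟫_ℂ := by
    rw [inner_sub_right, inner_self_eq_norm_sq_to_K, hv.1]
    simp
  rw [h, norm_neg]
  refine (norm_inner_le_norm _ _).trans_eq ?_
  rw [hv.1, one_mul]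

/-- A compact operator has diagonal coefficients vanishing at infinity. -/
theorem IsCompactOperator.tendsto_inner_orthonormal {ι H : Type*} [NormedAddCommGroup H]
    [InnerProductSpace ℂ H] [CompleteSpace H] {v : ι → H} (hv : Orthonormal ℂ v) {K : H →L[ℂ] H}
    (hK : IsCompactOperator K) : Tendsto (fun i => ⟪v i, K (v i)⟫_ℂ) cofinite (𝓝 0) := by
  refine squeeze_zero_norm (fun i => ?_)
    (tendsto_zero_iff_norm_tendsto_zero.1 (hK.tendsto_orthonormal hv))
  simpa [hv.1] using norm_inner_le_norm (𝕜 := ℂ) (v i) (K (v i))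

theorem Set.tendsto_indicator_cofinite {X M : Type*} [Zero M] [TopologicalSpace M] {A : Set X}
    {f : X → M} (h : Tendsto (fun x : A => f x) cofinite (𝓝 0)) :
    Tendsto (A.indicator f) cofinite (𝓝 0) := by
  intro U hU
  refine Set.Finite.subset ((h hU).image Subtype.val) fun x hx => ?_
  by_cases hA : x ∈ A
  · refine ⟨⟨x, hA⟩, ?_, rfl⟩
    simpa [Set.indicator_of_mem hA] using hx
  · refine (hx ?_).elim
    simpa [Set.indicator_of_notMem hA] using mem_of_mem_nhds hU

/-! ### Operators commuting with right translations -/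

section Translations

variable {G : Type*} [Group G] {H : Type*} [NormedAddCommGroup H] [InnerProductSpace ℂ H]
  (e : HilbertBasis G ℂ H)

/-- The unitary `e t ↦ e (θ t)`. -/
def HilbertBasis.permute {ι : Type*} (e : HilbertBasis ι ℂ H) (θ : ι ≃ ι) : H ≃ₗᵢ[ℂ] H :=
  (e.repr.trans (l2Reindex ℂ θ)).trans e.repr.symm

theorem HilbertBasis.permute_apply_basis {ι : Type*} (e : HilbertBasis ι ℂ H) (θ : ι ≃ ι) (i : ι) :
    e.permute θ (e i) = e (θ i) := by
  classical
  apply e.repr.injective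
  simp only [permute, LinearIsometryEquiv.trans_apply, LinearIsometryEquiv.apply_symm_apply,
    e.repr_self]
  ext j
  simp [lp.single_apply, Pi.single_apply, Equiv.symm_apply_eq]

/-- The unitary `e t ↦ e (p t)`. -/
def leftTranslation (p : G) : H →L[ℂ] H :=
  (e.permute (Equiv.mulLeft p)).toContinuousLinearEquiv.toContinuousLinearMap

/-- The unitary `e t ↦ e (t r⁻¹)`. -/
def rightTranslation (r : G) : H →L[ℂ] H :=
  (e.permute (Equiv.mulRight r⁻¹)).toContinuousLinearEquiv.toContinuousLinearMap

@[simp]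
theorem leftTranslation_apply (p t : G) : leftTranslation e p (e t) = e (p * t) :=
  e.permute_apply_basis _ _

@[simp]
theorem rightTranslation_apply (r t : G) : rightTranslation e r (e t) = e (t * r⁻¹) :=
  e.permute_apply_basis _ _

theorem inner_leftTranslation (p : G) (x y : H) :
    ⟪leftTranslation e p x, leftTranslation e p y⟫_ℂ = ⟪x, y⟫_ℂ :=
  LinearIsometryEquiv.inner_map_map (e.permute (Equiv.mulLeft p)) x y

theorem inner_rightTranslation (p : G) (x y : H) :
    ⟪rightTranslation e p x, rightTranslation e p y⟫_ℂ = ⟪x, y⟫_ℂ :=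
  LinearIsometryEquiv.inner_map_map (e.permute (Equiv.mulRight p⁻¹)) x y

theorem leftTranslation_mul (p q : G) :
    leftTranslation e (p * q) = leftTranslation e p * leftTranslation e q :=
  e.ext_operator fun t => by simp [mul_assoc]

theorem leftTranslation_one : leftTranslation e 1 = 1 :=
  e.ext_operator fun t => by simp

/-- Operators whose matrix coefficients with respect to `e` are invariant under right translations. -/
def IsRightInvariant (x : H →L[ℂ] H) : Prop :=
  ∀ s t r : G, ⟪e (s * r), x (e (t * r))⟫_ℂ = ⟪e s, x (e t)⟫_ℂ

variable {e}

theorem isRightInvariant_leftTranslation (p : G) : IsRightInvariant e (leftTranslation e p) := by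
  classical
  intro s t r
  simp [e.inner_eq_ite, ← mul_assoc]

theorem IsRightInvariant.commute {x : H →L[ℂ] H} (hx : IsRightInvariant e x) (r : G) :
    x * rightTranslation e r = rightTranslation e r * x := by
  refine e.ext_matrix fun s t => ?_
  have h : ⟪e s, rightTranslation e r (x (e t))⟫_ℂ = ⟪e (s * r), x (e t)⟫_ℂ := by
    rw [← inner_rightTranslation e r (e (s * r))]
    simp
  rw [mul_apply_eq_comp, mul_apply_eq_comp, h, rightTranslation_apply, ← hx s _ r,
    inv_mul_cancel_right]

theorem IsRightInvariant.of_commute {x : H →L[ℂ] H}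
    (h : ∀ r, x * rightTranslation e r = rightTranslation e r * x) : IsRightInvariant e x := by
  intro s t r
  have h1 : x (e t) = rightTranslation e r (x (e (t * r))) := by
    have := DFunLike.congr_fun (h r) (e (t * r))
    simpa using this
  rw [h1, ← inner_rightTranslation e r (e (s * r))]
  simp

variable [CompleteSpace H]

variable (e) in
theorem star_leftTranslation (p : G) : star (leftTranslation e p) = leftTranslation e p⁻¹ := by
  refine e.ext_matrix fun s t => ?_
  rw [ContinuousLinearMap.star_eq_adjoint, ContinuousLinearMap.adjoint_inner_right,
    ← inner_leftTranslation e p (e s)]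
  simp

theorem IsRightInvariant.star {x : H →L[ℂ] H} (hx : IsRightInvariant e x) :
    IsRightInvariant e (star x) := by
  intro s t r
  rw [ContinuousLinearMap.star_eq_adjoint, ContinuousLinearMap.adjoint_inner_right,
    ContinuousLinearMap.adjoint_inner_right, ← inner_conj_symm, hx, inner_conj_symm]

/-- The commutation theorem: a von Neumann algebra, generated by right invariant operators, which
contains all left translations, consists of all right invariant operators. -/
theorem mem_generatedBy_iff_isRightInvariant {S : Set (H →L[ℂ] H)}
    (hS : ∀ x ∈ S, IsRightInvariant e x)
    (hW : ∀ p, leftTranslation e p ∈ VonNeumannAlgebra.generatedBy S) {x : H →L[ℂ] H} :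
    x ∈ VonNeumannAlgebra.generatedBy S ↔ IsRightInvariant e x := by
  constructor
  · intro hx
    refine .of_commute fun r => (VonNeumannAlgebra.mem_generatedBy.1 hx _ fun s hs => ?_).symm
    exact ⟨(hS s hs).commute r, (hS s hs).star.commute r⟩
  · intro hx
    refine VonNeumannAlgebra.mem_generatedBy.2 fun y hy => ?_
    have hyW (p s t : G) : ⟪e (p * s), y (e (p * t))⟫_ℂ = ⟪e s, y (e t)⟫_ℂ := by
      have h := DFunLike.congr_fun (VonNeumannAlgebra.mem_generatedBy.1 (hW p) y hy) (e t)
      -- An element of the commutant commutes with left translations, so its matrix is left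
      -- invariant.
      simp only [mul_apply_eq_comp, leftTranslation_apply] at h
      rw [h, ← leftTranslation_apply, inner_leftTranslation]
    refine e.ext_matrix fun s t => ?_
    refine (e.hasSum_matrix_mul y x s t).unique ?_
    have h := e.hasSum_matrix_mul x y s t
    -- The substitution r ↦ t r⁻¹ s matches the sum for the (s,t) entry of xy with the one for yx
    -- term by term, by right invariance of x and left invariance of y.
    let θ : G ≃ G := (Equiv.inv G).trans ((Equiv.mulLeft t).trans (Equiv.mulRight s))
    rw [← θ.hasSum_iff] at h
    convert! h using 2 with r
    have h1 : ⟪e (t * r⁻¹ * s), y (e t)⟫_ℂ = ⟪e s, y (e r)⟫_ℂ := by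
      rw [← hyW (t * r⁻¹) s r, inv_mul_cancel_right]
    have h2 : ⟪e s, x (e (t * r⁻¹ * s))⟫_ℂ = ⟪e r, x (e t)⟫_ℂ := by
      rw [← hx r t (r⁻¹ * s), mul_inv_cancel_left, mul_assoc]
    change _ = ⟪e s, x (e (t * r⁻¹ * s))⟫_ℂ * ⟪e (t * r⁻¹ * s), y (e t)⟫_ℂ
    rw [h1, h2, mul_comm]

end Translations

/-! ### Positive elements of a C⋆-algebra -/

section CStarAlgebra

variable {A : Type*} [NonUnitalCStarAlgebra A] [PartialOrder A] [StarOrderedRing A]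

theorem NonUnitalCStarAlgebra.exists_eq_star_mul_self {a : A} (ha : 0 ≤ a) :
    ∃ b, a = star b * b :=
  CStarAlgebra.nonneg_iff_eq_star_mul_self.1 ha

/-- A self-adjoint element whose compressions are not strictly negative is positive. -/
theorem IsSelfAdjoint.nonneg_of_compression {a : A} (ha : IsSelfAdjoint a)
    (h : ∀ y z : A, star y * a * y = -(star z * z) → z = 0) : 0 ≤ a := by
  have hsa : IsSelfAdjoint a⁻ := (CFC.negPart_nonneg a).isSelfAdjoint
  -- The compression is tested at y = a⁻, where it equals minus the cube of a⁻. The hypothesis then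
  -- forces this cube, and so a⁻, to vanish.
  have hmul : a⁻ * a * a⁻ = -(a⁻ * a⁻ * a⁻) := by
    nth_rw 2 [← CFC.posPart_sub_negPart a ha]
    rw [mul_sub, CFC.negPart_mul_posPart, zero_sub, neg_mul]
  have hpos : 0 ≤ a⁻ * a⁻ * a⁻ := by
    have := star_left_conjugate_nonneg (CFC.negPart_nonneg a) a⁻
    rwa [hsa.star_eq] at this
  obtain ⟨z, hz⟩ := NonUnitalCStarAlgebra.exists_eq_star_mul_self hpos
  have hz0 : z = 0 := h a⁻ z (by rw [hsa.star_eq, hmul, hz])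
  have hcube : a⁻ * a⁻ * a⁻ = 0 := by rw [hz, hz0, mul_zero]
  have hsq : a⁻ * a⁻ = 0 := by
    rw [← CStarRing.star_mul_self_eq_zero_iff, star_mul, hsa.star_eq, ← mul_assoc, hcube, zero_mul]
  have hzero : a⁻ = 0 := by
    rw [← CStarRing.star_mul_self_eq_zero_iff, hsa.star_eq, hsq]
  exact (CFC.negPart_eq_zero_iff a ha).1 hzero

end CStarAlgebra

/-! ### Positive matrices over a von Neumann algebra -/

namespace VonNeumannAlgebra

variable {H : Type u} [NormedAddCommGroup H] [InnerProductSpace ℂ H] [CompleteSpace H]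
  {N : VonNeumannAlgebra H} {n : Type*} [Fintype n]

/-- The action of a matrix of operators on tuples of vectors. -/
def matrixAct (A : CStarMatrix n n N) (v : n → H) (i : n) : H :=
  ∑ j, (A i j : H →L[ℂ] H) (v j)

theorem matrixAct_mul (A B : CStarMatrix n n N) (v : n → H) :
    matrixAct (A * B) v = matrixAct A (matrixAct B v) := by
  ext i
  simp only [matrixAct, CStarMatrix.mul_apply, map_sum, AddSubmonoidClass.coe_finsetSum,
    sum_apply]
  exact Finset.sum_comm

theorem sum_inner_matrixAct_star (A : CStarMatrix n n N) (v w : n → H) :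
    ∑ i, ⟪v i, matrixAct (star A) w i⟫_ℂ = ∑ i, ⟪matrixAct A v i, w i⟫_ℂ := by
  simp only [matrixAct, inner_sum, sum_inner]
  rw [Finset.sum_comm]
  refine Finset.sum_congr rfl fun i _ => Finset.sum_congr rfl fun j _ => ?_
  exact ContinuousLinearMap.adjoint_inner_right _ _ _

theorem sum_inner_matrixAct_star_mul (A : CStarMatrix n n N) (v : n → H) :
    ∑ i, ⟪v i, matrixAct (star A * A) v i⟫_ℂ = ∑ i, (‖matrixAct A v i‖ ^ 2 : ℂ) := by
  simp only [matrixAct_mul, sum_inner_matrixAct_star, inner_self_eq_norm_sq_to_K]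
  rfl

theorem sum_inner_matrixAct_nonneg {A : CStarMatrix n n N} (hA : 0 ≤ A) (v : n → H) :
    0 ≤ ∑ i, ⟪v i, matrixAct A v i⟫_ℂ := by
  obtain ⟨B, rfl⟩ := NonUnitalCStarAlgebra.exists_eq_star_mul_self hA
  rw [sum_inner_matrixAct_star_mul]
  exact Finset.sum_nonneg fun i _ => by norm_cast; positivity

theorem eq_zero_of_matrixAct_eq_zero {A : CStarMatrix n n N} (h : ∀ v : n → H, matrixAct A v = 0) :
    A = 0 := by
  classical
  ext i j : 1
  refine Subtype.ext (ContinuousLinearMap.ext fun x => ?_)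
  have := congrFun (h (Pi.single j x)) i
  rw [matrixAct, Finset.sum_eq_single j (fun k _ hk => by simp [hk]) (by simp)] at this
  simpa using this

/-- A self-adjoint matrix with nonnegative quadratic form is a positive element. -/
theorem nonneg_of_sum_inner_matrixAct_nonneg {A : CStarMatrix n n N}
    (hA : IsSelfAdjoint A) (h : ∀ v : n → H, 0 ≤ ∑ i, ⟪v i, matrixAct A v i⟫_ℂ) : 0 ≤ A := by
  -- If Y*AY = -Z*Z, the form of A at Yv is both nonnegative and equal to -‖Zv‖², so Zv = 0.
  refine hA.nonneg_of_compression fun Y Z hZ => eq_zero_of_matrixAct_eq_zero fun v => ?_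
  have h1 := h (matrixAct Y v)
  rw [← sum_inner_matrixAct_star, ← matrixAct_mul, ← matrixAct_mul, hZ] at h1
  have h2 : ∑ i, ⟪v i, matrixAct (-(star Z * Z)) v i⟫_ℂ =
      -∑ i, ⟪v i, matrixAct (star Z * Z) v i⟫_ℂ := by
    simp [matrixAct, inner_sum]
  rw [h2, sum_inner_matrixAct_star_mul, neg_nonneg] at h1
  norm_cast at h1
  have h3 := (Finset.sum_eq_zero_iff_of_nonneg (fun i _ => by positivity)).1
    (le_antisymm h1 (Finset.sum_nonneg fun i _ => by positivity))
  ext i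
  simpa using h3 i (Finset.mem_univ i)

end VonNeumannAlgebra

/-! ### Kernels and vectors -/

/-- The 2 × 2 matrix at the points 1, g is Hermitian. -/
theorem IsPositiveDefinite.star_apply {G : Type*} [Group G] {φ : G → ℂ}
    (hφ : IsPositiveDefinite φ) (g : G) : starRingEnd ℂ (φ g) = φ g⁻¹ := by
  simpa using (hφ 2 ![1, g]).1.apply 1 0

/-- Evaluating the definition at inverses turns the kernel φ(g⁻¹h) into φ(xy⁻¹), the form that right
invariant matrices require. -/
theorem IsPositiveDefinite.sum_nonneg {G : Type*} [Group G] {φ : G → ℂ}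
    (hφ : IsPositiveDefinite φ) (s : Finset G) (c : G → ℂ) :
    0 ≤ ∑ x ∈ s, ∑ y ∈ s, star (c x) * (φ (x * y⁻¹) * c y) := by
  have h := (hφ _ fun i => ((s.equivFin.symm i : s) : G)⁻¹).dotProduct_mulVec_nonneg
    fun i => c (s.equivFin.symm i : s)
  simp only [dotProduct, Matrix.mulVec, Finset.mul_sum, Pi.star_apply, Matrix.of_apply,
    inv_inv] at h
  rw [Equiv.sum_comp s.equivFin.symm fun x : s => ∑ j, star (c x) *
    (φ (x * ((s.equivFin.symm j : s) : G)⁻¹) * c (s.equivFin.symm j : s))] at h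
  simp_rw [fun x : s => Equiv.sum_comp s.equivFin.symm fun y : s => star (c x) *
    (φ (x * (y : G)⁻¹) * c y)] at h
  rw [← Finset.sum_coe_sort s]
  refine h.trans_eq (Finset.sum_congr rfl fun x _ => ?_)
  exact Finset.sum_coe_sort s fun y => star (c x) * (φ (x * y⁻¹) * c y)

/-- A positive definite function is given by a family of vectors in a Hilbert space. -/
theorem IsPositiveDefinite.exists_vectors {G : Type u} [Group G] {φ : G → ℂ}
    (hφ : IsPositiveDefinite φ) :
    ∃ (J : Type u) (v : G → lp (fun _ : J => ℂ) 2), ∀ s t, ⟪v s, v t⟫_ℂ = φ (s * t⁻¹) := by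
  let K : Matrix G G (ℂ →L[ℂ] ℂ) := .of fun s t => φ (s * t⁻¹) • 1
  have hK : K.PosSemidef := by
    have h := (RKHS.posSemidef_tfae (K := K)).out 0 2
    refine h.2 ⟨?_, fun c => ?_⟩
    · ext s t : 2
      simp [K, hφ.star_apply, Matrix.conjTranspose_apply]
    · have h := (Complex.nonneg_iff.1 (hφ.sum_nonneg c.support c)).1
      rw [← Complex.conj_re] at h
      simp_rw [map_sum] at h
      rw [Finset.sum_comm] at h
      refine h.trans_eq ?_
      simp [K, Finsupp.sum, mul_comm]
  have : Fact K.PosSemidef := ⟨hK⟩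
  obtain ⟨J, b, -⟩ := exists_hilbertBasis ℂ (RKHS.OfKernel K)
  -- The vectors are the kernel functions of the reproducing kernel Hilbert space, read in a Hilbert
  -- basis so that they live in an ℓ² space and can index the amplification ℓ²(J, H).
  refine ⟨J, fun s => b.repr (RKHS.kerFun (RKHS.OfKernel K) s 1), fun s t => ?_⟩
  rw [LinearIsometryEquiv.inner_map_map, ← RKHS.kernel_inner, RKHS.OfKernel.kernel_ofKernel]
  simp [K, hφ.star_apply]

/-! ### Schur multipliers -/

section Schur

variable {H : Type u} [NormedAddCommGroup H] [InnerProductSpace ℂ H]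

/-- The operator `x ⊗ 1` on `ℓ²(J, H)`. -/
def amplify (J : Type w) (x : H →L[ℂ] H) :
    lp (fun _ : J => H) 2 →L[ℂ] lp (fun _ : J => H) 2 :=
  lp.mapCLM 2 (fun _ => x) (norm_nonneg x) fun _ => le_rfl

@[simp]
theorem amplify_apply {J : Type w} (x : H →L[ℂ] H) (ξ : lp (fun _ : J => H) 2) (j : J) :
    amplify J x ξ j = x (ξ j) := by
  simp [amplify]

/-- V sends e_s to v_s ⊗ e_s. These vectors are orthonormal because the e_s are orthogonal and the
v_s are unit vectors; the v_s need not be orthogonal to each other. -/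
theorem HilbertBasis.exists_isometry_amplify [CompleteSpace H] {G : Type v} {J : Type w} (e : HilbertBasis G ℂ H)
    (v : G → lp (fun _ : J => ℂ) 2) (hv : ∀ s, ⟪v s, v s⟫_ℂ = 1) :
    ∃ V : H →ₗᵢ[ℂ] lp (fun _ : J => H) 2, ∀ (x : H →L[ℂ] H) (s t : G),
      ⟪V (e s), amplify J x (V (e t))⟫_ℂ = ⟪v s, v t⟫_ℂ * ⟪e s, x (e t)⟫_ℂ := by
  classical
  let f : G → lp (fun _ : J => H) 2 := fun s =>
    lp.mapCLM 2 (fun _ => ContinuousLinearMap.toSpanSingleton ℂ (e s)) (norm_nonneg _)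
      (fun _ => le_rfl) (v s)
  have hf (s : G) (j : J) : f s j = v s j • e s := by simp [f]
  have key (x : H →L[ℂ] H) (s t : G) :
      ⟪f s, amplify J x (f t)⟫_ℂ = ⟪v s, v t⟫_ℂ * ⟪e s, x (e t)⟫_ℂ := by
    rw [lp.inner_eq_tsum, lp.inner_eq_tsum, ← tsum_mul_right]
    refine tsum_congr fun j => ?_
    simp [hf, inner_smul_left, inner_smul_right, mul_assoc]
  have hone : amplify J (1 : H →L[ℂ] H) = 1 := by
    ext ξ j
    simp
  have horth : Orthonormal ℂ f := by
    rw [orthonormal_iff_ite]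
    intro s t
    have h := key 1 s t
    rw [hone] at h
    simp only [one_apply_eq_self, e.inner_eq_ite] at h
    rw [h]
    split_ifs with hst
    · rw [← hst, hv, one_mul]
    · rw [mul_zero]
  obtain ⟨W, hW⟩ : ∃ W : lp (fun _ : G => ℂ) 2 →ₗᵢ[ℂ] lp (fun _ : J => H) 2,
      ∀ s, W (lp.single 2 s 1) = f s :=
    ⟨(Orthonormal.orthogonalFamily horth).linearIsometry, fun s =>
      (OrthogonalFamily.linearIsometry_apply_single _ _).trans (by simp)⟩
  refine ⟨W.comp e.repr.toLinearIsometry, fun x s t => ?_⟩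
  have hV (s : G) : W.comp e.repr.toLinearIsometry (e s) = f s := by
    rw [← hW, ← e.repr_self]
    rfl
  rw [hV, hV, key]

variable [CompleteSpace H]

/-- The compression of `x ⊗ 1` to `H` by `V : H → ℓ²(J, H)`. -/
def compress {J : Type w} (V : H →L[ℂ] lp (fun _ : J => H) 2) : (H →L[ℂ] H) →ₗ[ℂ] (H →L[ℂ] H) where
  toFun x := ContinuousLinearMap.adjoint V ∘L amplify J x ∘L V
  map_add' x y := by
    ext ξ
    have h : amplify J (x + y) = amplify J x + amplify J y := by ext; simp
    simp [h]
  map_smul' c x := by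
    ext ξ
    have h : amplify J (c • x) = c • amplify J x := by ext; simp
    simp [h]

variable {J : Type w} (V : H →L[ℂ] lp (fun _ : J => H) 2)

theorem inner_compress (x : H →L[ℂ] H) (ξ η : H) :
    ⟪ξ, compress V x η⟫_ℂ = ⟪V ξ, amplify J x (V η)⟫_ℂ :=
  ContinuousLinearMap.adjoint_inner_right V ξ (amplify J x (V η))

theorem star_compress (x : H →L[ℂ] H) : star (compress V x) = compress V (star x) := by
  refine ContinuousLinearMap.ext fun η => ext_inner_left ℂ fun ξ => ?_
  rw [ContinuousLinearMap.star_eq_adjoint, ContinuousLinearMap.adjoint_inner_right,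
    ← inner_conj_symm, inner_compress, inner_compress, inner_conj_symm, lp.inner_eq_tsum,
    lp.inner_eq_tsum]
  refine tsum_congr fun j => ?_
  simp [ContinuousLinearMap.star_eq_adjoint, ContinuousLinearMap.adjoint_inner_right]

theorem compress_one (V : H →ₗᵢ[ℂ] lp (fun _ : J => H) 2) :
    compress V.toContinuousLinearMap 1 = 1 := by
  refine ContinuousLinearMap.ext fun η => ext_inner_left ℂ fun ξ => ?_
  have h : amplify J (1 : H →L[ℂ] H) = 1 := by ext; simp
  rw [inner_compress, h]
  simp

/-- The compression as a completely positive map of a von Neumann algebra. -/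
def compressCP (N : VonNeumannAlgebra H) (hV : ∀ x ∈ N, compress V x ∈ N) :
    CompletelyPositiveMap N N where
  toFun x := ⟨compress V x, hV x x.2⟩
  map_add' x y := Subtype.ext (map_add (compress V) x.1 y.1)
  map_smul' c x := Subtype.ext (map_smul (compress V) c x.1)
  map_cstarMatrix_nonneg' k M hM := by
    refine VonNeumannAlgebra.nonneg_of_sum_inner_matrixAct_nonneg ?_ fun v => ?_
    · refine CStarMatrix.ext fun i j => Subtype.ext ?_
      have h : star (M j i) = M i j := by
        conv_rhs => rw [← (IsSelfAdjoint.of_nonneg hM).star_eq]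
        rfl
      change star (compress V (M j i)) = compress V (M i j)
      rw [star_compress, ← h]
      rfl
    -- The form of the compressed matrix splits over the coordinates l ∈ J into forms of `M` at the
    -- tuples (V v_j)(l), each nonnegative.
    · have h : HasSum (fun l => ∑ i, ⟪V (v i) l,
          VonNeumannAlgebra.matrixAct M (fun j => V (v j) l) i⟫_ℂ)
          (∑ i, ∑ j, ⟪V (v i), amplify J (M i j) (V (v j))⟫_ℂ) := by
        simp only [VonNeumannAlgebra.matrixAct, inner_sum]
        refine hasSum_sum fun i _ => hasSum_sum fun j _ => ?_
        simpa using lp.hasSum_inner (V (v i)) (amplify J (M i j) (V (v j)))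
      have h2 : 0 ≤ ∑ i, ∑ j, ⟪V (v i), amplify J (M i j) (V (v j))⟫_ℂ :=
        h.nonneg fun l => VonNeumannAlgebra.sum_inner_matrixAct_nonneg hM _
      refine h2.trans_eq (Finset.sum_congr rfl fun i _ => ?_)
      rw [VonNeumannAlgebra.matrixAct, inner_sum]
      exact Finset.sum_congr rfl fun j _ => (inner_compress V _ _ _).symm

end Schur

/-- Positive definite functions give completely positive multipliers of group von Neumann
algebras. -/
theorem IsPositiveDefinite.exists_multiplier {G : Type v} [Group G] {H : Type u}
    [NormedAddCommGroup H] [InnerProductSpace ℂ H] [CompleteSpace H] (e : HilbertBasis G ℂ H)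
    {N : VonNeumannAlgebra H} (hN : ∀ x, x ∈ N ↔ IsRightInvariant e x) {φ : G → ℂ}
    (hφ : IsPositiveDefinite φ) (h1 : φ 1 = 1) :
    ∃ Ψ : CompletelyPositiveMap N N, Ψ 1 = 1 ∧ ∀ (x : N) (s t : G),
      ⟪e s, (Ψ x : H →L[ℂ] H) (e t)⟫_ℂ = φ (s * t⁻¹) * ⟪e s, (x : H →L[ℂ] H) (e t)⟫_ℂ := by
  obtain ⟨J, v, hv⟩ := hφ.exists_vectors
  obtain ⟨V, hV⟩ := e.exists_isometry_amplify v fun s => by rw [hv, mul_inv_cancel, h1]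
  have hmat (x : H →L[ℂ] H) (s t : G) : ⟪e s, compress V.toContinuousLinearMap x (e t)⟫_ℂ =
      φ (s * t⁻¹) * ⟪e s, x (e t)⟫_ℂ := by
    rw [inner_compress, ← hv]
    exact hV x s t
  refine ⟨compressCP V.toContinuousLinearMap N fun x hx => (hN _).2 fun s t r => ?_,
    Subtype.ext (compress_one V), fun x s t => hmat x s t⟩
  -- The factor φ(st⁻¹) is unchanged when s and t are multiplied on the right by r, so the
  -- multiplier stays inside `N`.
  rw [hmat, hmat, (hN x).1 hx]
  simp

/-! ### Positive definite functions and completely positive maps -/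

section Multipliers

variable {G : Type v} [Group G] {H : Type u} [NormedAddCommGroup H] [InnerProductSpace ℂ H]
  [CompleteSpace H] {e : HilbertBasis G ℂ H} {N : VonNeumannAlgebra H}

/-- Cauchy–Schwarz for the representing vectors, which have norm 1. -/
theorem IsPositiveDefinite.norm_le_one {φ : G → ℂ} (hφ : IsPositiveDefinite φ) (h1 : φ 1 = 1)
    (s : G) : ‖φ s‖ ≤ 1 := by
  obtain ⟨J, v, hv⟩ := hφ.exists_vectors
  have hn (s : G) : ‖v s‖ = 1 := by
    have h := inner_self_eq_norm_sq_to_K (𝕜 := ℂ) (v s)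
    rw [hv, mul_inv_cancel, h1] at h
    have h2 : ‖v s‖ ^ 2 = 1 := by
      have := congrArg Complex.re h
      norm_cast at this
      exact this.symm
    exact (pow_eq_one_iff_of_nonneg (norm_nonneg _) two_ne_zero).1 h2
  have h := norm_inner_le_norm (𝕜 := ℂ) (v s) (v 1)
  rwa [hv, hn, hn, inv_one, mul_one, mul_one] at h

theorem IsPositiveDefinite.smul {φ : G → ℂ} (hφ : IsPositiveDefinite φ) {c : ℂ} (hc : 0 ≤ c) :
    IsPositiveDefinite fun s => c * φ s := fun n g =>
  (hφ n g).smul hc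

/-- The function associated with a completely positive map is positive definite. -/
theorem CompletelyPositiveMap.isPositiveDefinite (hN : ∀ x, x ∈ N ↔ IsRightInvariant e x)
    (Ψ : CompletelyPositiveMap N N) {w : G → N} (hw : ∀ s, (w s : H →L[ℂ] H) = leftTranslation e s) :
    IsPositiveDefinite fun s => ⟪e s, (Ψ (w s) : H →L[ℂ] H) (e 1)⟫_ℂ := by
  intro n g
  have hstar (s : G) : star (w s) = w s⁻¹ := Subtype.ext <| by
    rw [hw, ← star_leftTranslation, ← hw]
    rfl
  let A : CStarMatrix (Fin n) (Fin n) N := CStarMatrix.ofMatrix fun i j => w ((g i)⁻¹ * g j)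
  have hAsa : IsSelfAdjoint A := CStarMatrix.ext fun i j => by
    change star (w ((g j)⁻¹ * g i)) = w ((g i)⁻¹ * g j)
    simp [hstar]
  have hA : 0 ≤ A := by
    refine VonNeumannAlgebra.nonneg_of_sum_inner_matrixAct_nonneg hAsa fun v => ?_
    -- The matrix is R*R for the row R of left translations by the g_i, so its form is a squared
    -- norm.
    have h : ∑ i, ⟪v i, VonNeumannAlgebra.matrixAct A v i⟫_ℂ =
        ⟪∑ i, leftTranslation e (g i) (v i), ∑ i, leftTranslation e (g i) (v i)⟫_ℂ := by
      rw [sum_inner]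
      refine Finset.sum_congr rfl fun i _ => ?_
      rw [VonNeumannAlgebra.matrixAct, inner_sum, inner_sum]
      refine Finset.sum_congr rfl fun j _ => ?_
      change ⟪v i, (w ((g i)⁻¹ * g j) : H →L[ℂ] H) (v j)⟫_ℂ = _
      rw [hw, leftTranslation_mul, ← star_leftTranslation, ContinuousLinearMap.star_eq_adjoint,
        mul_apply_eq_comp, ContinuousLinearMap.adjoint_inner_right]
    rw [h, inner_self_eq_norm_sq_to_K]
    norm_cast
    positivity
  have hΨA : 0 ≤ A.map Ψ := Ψ.map_cstarMatrix_nonneg A hA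
  -- Right invariance shifts the vector at 1 to the one at g_j⁻¹, so the scalar matrix becomes the
  -- form of Ψ(A) on the tuple c_i e(g_i⁻¹).
  have hentry (i j : Fin n) :
      ⟪e ((g i)⁻¹ * g j), (Ψ (w ((g i)⁻¹ * g j)) : H →L[ℂ] H) (e 1)⟫_ℂ =
        ⟪e (g i)⁻¹, ((A.map Ψ i j : N) : H →L[ℂ] H) (e (g j)⁻¹)⟫_ℂ := by
    change _ = ⟪e (g i)⁻¹, (Ψ (w ((g i)⁻¹ * g j)) : H →L[ℂ] H) (e (g j)⁻¹)⟫_ℂ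
    rw [← (hN _).1 (Ψ (w ((g i)⁻¹ * g j))).2 (g i)⁻¹ (g j)⁻¹ (g j)]
    simp
  refine .of_dotProduct_mulVec_nonneg ?_ fun c => ?_
  · ext i j
    have hij : star (A.map Ψ j i) = A.map Ψ i j := by
      conv_rhs => rw [← (IsSelfAdjoint.of_nonneg hΨA).star_eq]
      rfl
    simp only [Matrix.conjTranspose_apply, Matrix.of_apply]
    rw [hentry, hentry, ← hij, RCLike.star_def, inner_conj_symm]
    exact (ContinuousLinearMap.adjoint_inner_right _ _ _).symm
  · have h := VonNeumannAlgebra.sum_inner_matrixAct_nonneg hΨA fun i => c i • e (g i)⁻¹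
    refine h.trans_eq (Finset.sum_congr rfl fun i _ => ?_)
    simp only [VonNeumannAlgebra.matrixAct, inner_sum, Matrix.mulVec, dotProduct, Finset.mul_sum,
      Matrix.of_apply, hentry]
    refine Finset.sum_congr rfl fun j _ => ?_
    simp [inner_smul_left, inner_smul_right, mul_comm, mul_left_comm]

end Multipliers

/-! ### Convergence of multipliers and normalisation -/

/-- Dominated convergence for the squared coefficients: |1 - φ| ≤ 2 gives the majorant 4|⟪e_s, x⟫|².
-/
theorem HilbertBasis.tendsto_norm_zero {ι H : Type*} [NormedAddCommGroup H]
    [InnerProductSpace ℂ H] (e : HilbertBasis ι ℂ H) {φ : ℕ → ι → ℂ}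
    (hφ : ∀ n s, ‖φ n s‖ ≤ 1) (hlim : ∀ s, Tendsto (fun n => ‖1 - φ n s‖) atTop (𝓝 0)) {x : H}
    {y : ℕ → H} (hy : ∀ n s, ⟪e s, y n⟫_ℂ = φ n s * ⟪e s, x⟫_ℂ) :
    Tendsto (fun n => ‖y n - x‖) atTop (𝓝 0) := by
  have hcoef (n : ℕ) (s : ι) : ‖⟪e s, y n - x⟫_ℂ‖ ^ 2 = ‖1 - φ n s‖ ^ 2 * ‖⟪e s, x⟫_ℂ‖ ^ 2 := by
    rw [inner_sub_right, hy, ← mul_pow, ← norm_mul, ← norm_neg]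
    ring_nf
  have h : Tendsto (fun n => ∑' s, ‖⟪e s, y n - x⟫_ℂ‖ ^ 2) atTop (𝓝 (∑' _ : ι, (0 : ℝ))) := by
    refine tendsto_tsum_of_dominated_convergence (bound := fun s => 4 * ‖⟪e s, x⟫_ℂ‖ ^ 2)
      ((e.hasSum_norm_sq x).summable.mul_left 4) (fun s => ?_) (Eventually.of_forall fun n s => ?_)
    · simp only [hcoef]
      simpa using ((hlim s).pow 2).mul_const (‖⟪e s, x⟫_ℂ‖ ^ 2)
    · rw [hcoef, norm_mul, norm_pow, norm_pow, norm_norm, norm_norm]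
      have h2 : ‖1 - φ n s‖ ≤ 2 := (norm_sub_le _ _).trans (by rw [norm_one]; linarith [hφ n s])
      have h3 : ‖1 - φ n s‖ ^ 2 ≤ 4 := by nlinarith [norm_nonneg (1 - φ n s)]
      gcongr
  simp only [(e.hasSum_norm_sq _).tsum_eq, tsum_zero] at h
  simpa using h.sqrt

/-- The positive definite functions in the Haagerup property from below can be normalised. -/
theorem GroupHaagerupFromBelow.exists_normalized {G : Type u} [Group G] {L : Subgroup G}
    (h : GroupHaagerupFromBelow G L) :
    ∃ φ : ℕ → G → ℂ,
      (∀ n, IsPositiveDefinite (φ n)) ∧ (∀ n, φ n 1 = 1) ∧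
      (∀ g, Tendsto (fun n => ‖1 - φ n g‖) atTop (𝓝 0)) ∧
      ∀ n, Tendsto (fun x : L => φ n x) cofinite (𝓝 0) := by
  obtain ⟨ψ, hψ, hlim, hC⟩ := h
  have hlim' (g : G) : Tendsto (fun n => ψ n g) atTop (𝓝 1) := by
    rw [tendsto_iff_norm_sub_tendsto_zero]
    simpa [norm_sub_rev] using hlim g
  -- As ψ_n(1) → 1, dropping the first m terms makes division by ψ_n(1) possible.
  obtain ⟨m, hm⟩ := eventually_atTop.1 ((hlim' 1).eventually_ne one_ne_zero)
  have hne (n : ℕ) : ψ (n + m) 1 ≠ 0 := hm _ (Nat.le_add_left m n)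
  refine ⟨fun n g => (ψ (n + m) 1)⁻¹ * ψ (n + m) g, fun n => (hψ _).smul ?_,
    fun n => inv_mul_cancel₀ (hne n), fun g => ?_, fun n => ?_⟩
  · have h1 : 0 ≤ ψ (n + m) 1 := by
      simpa using (hψ (n + m) 1 ![1]).diag_nonneg (i := 0)
    exact inv_nonneg.2 h1
  · have h1 := ((((hlim' 1).inv₀ one_ne_zero).mul (hlim' g)).const_sub 1).norm
    have h2 := h1.comp (tendsto_add_atTop_nat m)
    simp only [inv_one, one_mul, sub_self, norm_zero] at h2
    exact h2
  · simpa using (hC (n + m)).const_mul (ψ (n + m) 1)⁻¹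

/-! ### The crossed product `LΛ ⋊ Γ` -/

namespace GroupVNA

variable {Γ : Type u} [Group Γ] {Λ : Type v} [Group Λ] (α : Γ →* MulAut Λ)

variable (Γ Λ) in
/-- The Hilbert space `L²(LΛ ⋊ Γ) = ℓ²(Γ, ℓ²(Λ))`. -/
abbrev L2Crossed := lp (fun _ : Γ => lp (fun _ : Λ => ℂ) 2) 2

open Classical in
/-- The vector `λ_g u_γ Ω` of `L²(LΛ ⋊ Γ)`. -/
def crossedVector (t : Λ ⋊[α] Γ) : L2Crossed Γ Λ :=
  -- The twist appears because LΛ acts in the fibre over γ through σ_{γ⁻¹}, and σ_{γ⁻¹}(λ_g) δ_e is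
  -- supported at γ⁻¹·g.
  lp.single 2 t.right (lp.single 2 (α t.right⁻¹ t.left) 1)

open Classical in
theorem crossedVector_apply (t : Λ ⋊[α] Γ) (γ : Γ) (x : Λ) :
    crossedVector α t γ x = if t.right = γ ∧ t.left = α γ x then 1 else 0 := by
  have hx : x = α t.right⁻¹ t.left ↔ t.left = α t.right x := by
    rw [map_inv, MulAut.inv_def, MulEquiv.eq_symm_apply, eq_comm]
  by_cases h : t.right = γ
  · subst h
    by_cases h2 : x = α t.right⁻¹ t.left
    · rw [if_pos ⟨rfl, hx.1 h2⟩]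
      subst h2
      simp [crossedVector]
    · rw [if_neg fun h3 => h2 (hx.2 h3.2)]
      simp [crossedVector, lp.single_apply, -map_inv, h2]
  · simp [crossedVector, lp.single_apply, h, Ne.symm h]

open Classical in
theorem inner_crossedVector (t : Λ ⋊[α] Γ) (ξ : L2Crossed Γ Λ) :
    ⟪crossedVector α t, ξ⟫_ℂ = ξ t.right (α t.right⁻¹ t.left) := by
  rw [crossedVector, lp.inner_single_left, lp.inner_single_left]
  simp

/-- The Hilbert basis `λ_g u_γ Ω` of `L²(LΛ ⋊ Γ)`. -/
def crossedBasis : HilbertBasis (Λ ⋊[α] Γ) ℂ (L2Crossed Γ Λ) :=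
  HilbertBasis.mkOfOrthogonalEqBot (v := crossedVector α)
    (by
      classical
      rw [orthonormal_iff_ite]
      intro s t
      rw [inner_crossedVector, crossedVector_apply]
      simp [SemidirectProduct.ext_iff, eq_comm, and_comm])
    (by
      rw [Submodule.eq_bot_iff]
      intro ξ hξ
      ext γ x
      have h := (Submodule.mem_orthogonal _ _).1 hξ (crossedVector α ⟨α γ x, γ⟩)
        (Submodule.subset_span ⟨_, rfl⟩)
      simpa [inner_crossedVector] using h)

theorem crossedBasis_apply (t : Λ ⋊[α] Γ) : crossedBasis α t = crossedVector α t := by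
  rw [crossedBasis, HilbertBasis.coe_mkOfOrthogonalEqBot]

theorem inner_crossedBasis (t : Λ ⋊[α] Γ) (ξ : L2Crossed Γ Λ) :
    ⟪crossedBasis α t, ξ⟫_ℂ = ξ t.right (α t.right⁻¹ t.left) := by
  rw [crossedBasis_apply, inner_crossedVector]

theorem vacuum_eq : (action α).vacuum = crossedBasis α 1 := by
  rw [crossedBasis_apply, crossedVector]
  simp [TracePreservingAction.vacuum, tracial, δ]

theorem u_eq (γ : Γ) : (action α).u γ = leftTranslation (crossedBasis α) (.inr γ) := by
  classical
  refine (crossedBasis α).ext_operator fun t => ?_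
  rw [leftTranslation_apply, crossedBasis_apply, crossedBasis_apply]
  ext δ x
  have h : (action α).u γ (crossedVector α t) δ = crossedVector α t (γ⁻¹ * δ) := by
    simp [TracePreservingAction.u]
  rw [h, crossedVector_apply, crossedVector_apply]
  have h2 : t.left = α (γ⁻¹ * δ) x ↔ α γ t.left = α δ x := by
    rw [map_mul, map_inv, MulAut.mul_apply, MulAut.inv_def, MulEquiv.eq_symm_apply]
  simp only [h2, eq_inv_mul_iff_mul_eq]
  simp

/-- Since b commutes with the right regular representation, each column of its matrix is a right
translate of b δ_e. -/
theorem apply_single {b : lp (fun _ : Λ => ℂ) 2 →L[ℂ] lp (fun _ : Λ => ℂ) 2} (hb : b ∈ alg Λ)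
    [DecidableEq Λ] (x y : Λ) : b (lp.single 2 y 1) x = b δ (x * y⁻¹) := by
  have h : (lp.single 2 y 1 : lp (fun _ : Λ => ℂ) 2) = rightReg y⁻¹ δ := by
    ext z
    by_cases hz : z = y
    · simp [hz, rightReg_apply, δ_apply_one]
    · rw [rightReg_apply, δ_apply_of_ne (by simpa [mul_inv_eq_one] using hz)]
      simp [lp.single_apply, hz]
  rw [h, ← mul_apply_eq_comp, ← mul_rightReg hb, mul_apply_eq_comp, rightReg_apply]

theorem embed_apply (b : alg Λ) (ξ : L2Crossed Γ Λ) (γ : Γ) (x : Λ) :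
    (action α).embed b ξ γ x = b.1 (autUnitary (α γ) (ξ γ)) (α γ x) := by
  have h : (action α).embed b ξ γ =
      autUnitary (α γ⁻¹) (b.1 ((autUnitary (α γ⁻¹)).symm (ξ γ))) := rfl
  rw [h, autUnitary_symm, autUnitary_apply, ← map_inv, inv_inv]

-- The twists by α cancel: the entry depends only on whether s and t lie over the same element of Γ
-- and on the difference of their Λ-parts. This yields right invariance.
open Classical in
theorem inner_embed (b : alg Λ) (s t : Λ ⋊[α] Γ) :
    ⟪crossedBasis α s, (action α).embed b (crossedBasis α t)⟫_ℂ =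
      if s.right = t.right then b.1 δ (s.left * t.left⁻¹) else 0 := by
  rw [inner_crossedBasis, crossedBasis_apply]
  have h : α s.right (α s.right⁻¹ s.left) = s.left := by
    rw [map_inv, MulAut.apply_inv_self]
  rw [embed_apply, h, ← apply_single b.2]
  split_ifs with hst
  · have h1 : autUnitary (α s.right) (crossedVector α t s.right) = lp.single 2 t.left 1 := by
      ext x
      rw [autUnitary_apply, crossedVector_apply, MulAut.apply_inv_self]
      by_cases hx : t.left = x
      · subst hx
        simp [hst]
      · simp [lp.single_apply, hx, Ne.symm hx]
    rw [h1]
  · have h0 : crossedVector α t s.right = 0 := by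
      simp [crossedVector, lp.single_apply, hst]
    simp [h0]

theorem isRightInvariant_embed (b : alg Λ) :
    IsRightInvariant (crossedBasis α) ((action α).embed b) := by
  intro s t r
  rw [inner_embed, inner_embed]
  by_cases h : s.right = t.right <;> simp [h, mul_assoc]

/-- The unitary `λ_g` in `LΛ`. -/
def leftRegAlg (g : Λ) : alg Λ := ⟨leftReg g, VonNeumannAlgebra.subset_generatedBy ⟨g, rfl⟩⟩

theorem embed_leftRegAlg (g : Λ) :
    (action α).embed (leftRegAlg g) = leftTranslation (crossedBasis α) (.inl g) := by
  classical
  refine (crossedBasis α).ext_matrix fun s t => ?_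
  rw [inner_embed, leftTranslation_apply, (crossedBasis α).inner_eq_ite]
  change (if _ then leftReg g δ _ else 0) = _
  rw [leftReg_apply]
  by_cases h1 : s.right = t.right
  · by_cases h2 : s.left = g * t.left
    · have h3 : s = .inl g * t := by ext <;> simp [h1, h2]
      rw [if_pos h1, if_pos h3, h2, mul_inv_cancel_right, inv_mul_cancel, δ_apply_one]
    · have h3 : s ≠ .inl g * t := fun h => h2 (by simp [h])
      rw [if_pos h1, if_neg h3, δ_apply_of_ne]
      rwa [Ne, inv_mul_eq_one, eq_comm, mul_inv_eq_iff_eq_mul]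
  · have h3 : s ≠ .inl g * t := fun h => h1 (by simp [h])
    rw [if_neg h1, if_neg h3]

/-- This is LΛ ⋊ Γ = L(Λ ⋊ Γ). The commutation theorem applies because every left translation
factors as λ_g u_γ. -/
theorem mem_crossedProduct (x : L2Crossed Γ Λ →L[ℂ] L2Crossed Γ Λ) :
    x ∈ (action α).crossedProduct ↔ IsRightInvariant (crossedBasis α) x := by
  refine mem_generatedBy_iff_isRightInvariant ?_ fun p => ?_
  · rintro _ (⟨b, rfl⟩ | ⟨γ, rfl⟩)
    · exact isRightInvariant_embed α b
    · rw [u_eq]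
      exact isRightInvariant_leftTranslation _
  · rw [← SemidirectProduct.inl_left_mul_inr_right p, leftTranslation_mul, ← u_eq,
      ← embed_leftRegAlg]
    exact mul_mem (VonNeumannAlgebra.subset_generatedBy (.inl ⟨_, rfl⟩))
      (VonNeumannAlgebra.subset_generatedBy (.inr ⟨_, rfl⟩))

/-- One inclusion holds because vanishing coordinates define a closed subspace; the other expands ξ
in the basis vectors λ_g u_γ Ω. -/
theorem mem_l2Coset (γ : Γ) (ξ : L2Crossed Γ Λ) :
    ξ ∈ (action α).l2Coset γ ↔ ∀ t : Λ ⋊[α] Γ, t.right ≠ γ → ⟪crossedBasis α t, ξ⟫_ℂ = 0 := by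
  have hu : (action α).u γ (action α).vacuum = crossedBasis α (.inr γ) := by
    rw [u_eq, vacuum_eq, leftTranslation_apply, mul_one]
  constructor
  · intro hξ t ht
    have hle : (action α).l2Coset γ ≤ LinearMap.ker (innerSL ℂ (crossedBasis α t)).toLinearMap := by
      refine Submodule.topologicalClosure_minimal _ (Submodule.span_le.2 ?_)
        (ContinuousLinearMap.isClosed_ker _)
      rintro _ ⟨b, rfl⟩
      change ⟪crossedBasis α t, (action α).embed b ((action α).u γ (action α).vacuum)⟫_ℂ = 0
      rw [hu]
      exact (inner_embed α b _ _).trans (if_neg (by simpa using ht))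
    exact hle hξ
  · intro h
    refine mem_closure_of_tendsto ((crossedBasis α).hasSum_repr ξ)
      (Eventually.of_forall fun s => sum_mem fun t _ => ?_)
    rw [HilbertBasis.repr_apply_apply]
    by_cases ht : t.right = γ
    · refine Submodule.smul_mem _ _ (Submodule.subset_span ⟨leftRegAlg t.left, ?_⟩)
      change (action α).embed (leftRegAlg t.left) ((action α).u γ (action α).vacuum) = _
      rw [hu, embed_leftRegAlg, leftTranslation_apply, ← ht,
        SemidirectProduct.inl_left_mul_inr_right]
    · rw [h t ht, zero_smul]
      exact zero_mem _

open Classical in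
theorem condExp_crossedBasis (t : Λ ⋊[α] Γ) :
    (action α).condExp (crossedBasis α t) = if t.right = 1 then crossedBasis α t else 0 := by
  have : CompleteSpace ((action α).l2Coset 1) :=
    (Submodule.isClosed_topologicalClosure _).completeSpace_coe
  change ((action α).l2Coset 1).starProjection (crossedBasis α t) = _
  split_ifs with h
  · refine Submodule.starProjection_eq_self_iff.2 ((mem_l2Coset α 1 _).2 fun s hs => ?_)
    rw [HilbertBasis.inner_eq_ite, if_neg]
    rintro rfl
    exact hs h
  · refine (Submodule.starProjection_apply_eq_zero_iff _).2 ?_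
    refine (Submodule.mem_orthogonal' _ _).2 fun ξ hξ => ?_
    exact (mem_l2Coset α 1 ξ).1 hξ t h

end GroupVNA

/-! ### The two implications -/

namespace GroupVNA

variable {Γ : Type u} [Group Γ] {Λ : Type v} [Group Λ] (α : Γ →* MulAut Λ)

/-- Right multiplication by u_γ* thus extends to a bounded operator on L², which is needed to define
the compact operator on all of L². -/
theorem rightTranslation_apply_vacuum (γ : Γ) (x : (action α).crossedProduct) :
    rightTranslation (crossedBasis α) (.inr γ) (x.1 (action α).vacuum) =
      x.1 (star ((action α).u γ) (action α).vacuum) := by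
  have hc := DFunLike.congr_fun
    (((mem_crossedProduct α _).1 x.2).commute (.inr γ)) (crossedBasis α 1)
  rw [mul_apply_eq_comp, mul_apply_eq_comp, rightTranslation_apply] at hc
  rw [vacuum_eq, ← hc, u_eq, star_leftTranslation, leftTranslation_apply, one_mul, mul_one]

end GroupVNA

open GroupVNA in
theorem GroupHaagerupFromBelow.haagerupFromBelow {Γ : Type u} [Group Γ] {Λ : Type v} [Group Λ]
    {α : Γ →* MulAut Λ}
    (h : GroupHaagerupFromBelow (Λ ⋊[α] Γ) (SemidirectProduct.inl (φ := α)).range) :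
    (action α).HaagerupFromBelow := by
  classical
  obtain ⟨φ, hφ, hφ1, hlim, hC⟩ := h.exists_normalized
  have hle (n : ℕ) (s : Λ ⋊[α] Γ) : ‖φ n s‖ ≤ 1 := (hφ n).norm_le_one (hφ1 n) s
  let e := crossedBasis α
  choose Ψ hΨ1 hΨ using fun n =>
    (hφ n).exists_multiplier (crossedBasis α) (mem_crossedProduct α) (hφ1 n)
  have hvac (n : ℕ) (x : (action α).crossedProduct) (s : Λ ⋊[α] Γ) :
      ⟪crossedBasis α s, (Ψ n x).1 (action α).vacuum⟫_ℂ =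
        φ n s * ⟪crossedBasis α s, x.1 (action α).vacuum⟫_ℂ := by
    rw [vacuum_eq, hΨ, inv_one, mul_one]
  refine ⟨Ψ, fun n => (crossedBasis α).diagonal (φ n) 1 zero_le_one (hle n), hΨ1, fun n x => ?_,
    fun x => ?_, fun n γ ξ hξ => ?_, fun n γ => ?_⟩
  · refine (crossedBasis α).ext_inner fun s => ?_
    rw [HilbertBasis.inner_diagonal, hvac]
  · exact (crossedBasis α).tendsto_norm_zero hle hlim fun n s => hvac n x s
  · rw [mem_l2Coset] at hξ ⊢
    intro t ht
    rw [HilbertBasis.inner_diagonal, hξ t ht, mul_zero]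
  -- These are the diagonal coefficients of T_n ∘ E_B: φ_n on Λ and zero elsewhere, so they vanish
  -- at infinity on the whole group.
  · let c := ({s : Λ ⋊[α] Γ | s.right = 1} : Set (Λ ⋊[α] Γ)).indicator (φ n)
    have hle' (s : Λ ⋊[α] Γ) : ‖c s‖ ≤ 1 := (norm_indicator_le_norm_self _ _).trans (hle n s)
    have hc : Tendsto c cofinite (𝓝 0) := by
      have hset : {s : Λ ⋊[α] Γ | s.right = 1} =
          ((SemidirectProduct.inl (φ := α)).range : Set (Λ ⋊[α] Γ)) := by
        rw [SemidirectProduct.range_inl_eq_ker_rightHom]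
        rfl
      refine Set.tendsto_indicator_cofinite ?_
      rw [hset]
      exact hC n
    refine ⟨(crossedBasis α).diagonal c 1 zero_le_one hle' ∘L
      rightTranslation (crossedBasis α) (.inr γ),
      (crossedBasis α).isCompactOperator_diagonal_comp zero_le_one hle' hc _, fun x => ?_⟩
    have hK : (crossedBasis α).diagonal c 1 zero_le_one hle' =
        (crossedBasis α).diagonal (φ n) 1 zero_le_one (hle n) ∘L (action α).condExp := by
      refine (crossedBasis α).ext_operator fun t => ?_
      rw [ContinuousLinearMap.comp_apply, condExp_crossedBasis, HilbertBasis.diagonal_apply_basis]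
      by_cases ht : t.right = 1
      · rw [if_pos ht, HilbertBasis.diagonal_apply_basis]
        simp [c, ht]
      · rw [if_neg ht, map_zero]
        simp [c, ht]
    rw [ContinuousLinearMap.comp_apply, rightTranslation_apply_vacuum, hK]
    rfl

open GroupVNA in
theorem TracePreservingAction.HaagerupFromBelow.group {Γ : Type u} [Group Γ] {Λ : Type v} [Group Λ]
    {α : Γ →* MulAut Λ} (h : (action α).HaagerupFromBelow) :
    GroupHaagerupFromBelow (Λ ⋊[α] Γ) (SemidirectProduct.inl (φ := α)).range := by
  obtain ⟨Ψ, T, -, hT, hlim, -, hK⟩ := h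
  let w (s : Λ ⋊[α] Γ) : (action α).crossedProduct :=
    ⟨leftTranslation (crossedBasis α) s,
      (mem_crossedProduct α _).2 (isRightInvariant_leftTranslation s)⟩
  have hw (s : Λ ⋊[α] Γ) : (w s).1 (action α).vacuum = crossedBasis α s := by
    change leftTranslation (crossedBasis α) s _ = _
    rw [vacuum_eq, leftTranslation_apply, mul_one]
  refine ⟨fun n s => ⟪crossedBasis α s, (Ψ n (w s)).1 (crossedBasis α 1)⟫_ℂ,
    fun n => (Ψ n).isPositiveDefinite (mem_crossedProduct α) fun s => rfl, fun s => ?_, fun n => ?_⟩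
  · refine squeeze_zero (fun _ => norm_nonneg _) (fun n => ?_) (hlim (w s))
    have h2 : (Ψ n (w s) - w s : (action α).crossedProduct).1 (action α).vacuum =
        (Ψ n (w s)).1 (crossedBasis α 1) - crossedBasis α s := by
      rw [← hw s, ← vacuum_eq]
      rfl
    exact ((crossedBasis α).orthonormal.norm_one_sub_inner_le s _).trans_eq
      (congrArg norm h2).symm
  -- The case γ = 1 suffices: E_B fixes e_s for s ∈ Λ, so K e_s = Ψ_n(λ_s) Ω.
  · obtain ⟨K, hKc, hKx⟩ := hK n 1
    have hKe (s : Λ ⋊[α] Γ) (hs : s.right = 1) :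
        K (crossedBasis α s) = (Ψ n (w s)).1 (crossedBasis α 1) := by
      have h1 := hKx (w s)
      rw [hw, u_eq, star_leftTranslation, map_one, inv_one, leftTranslation_one,
        one_apply_eq_self, hw, condExp_crossedBasis, if_pos hs] at h1
      have h2 := hT n (w s)
      rw [hw, vacuum_eq] at h2
      exact h1.trans h2
    have hK0 := hKc.tendsto_inner_orthonormal ((crossedBasis α).orthonormal.comp
      (Subtype.val : (SemidirectProduct.inl (φ := α)).range → Λ ⋊[α] Γ) Subtype.val_injective)
    refine hK0.congr fun x => ?_
    obtain ⟨_, g, rfl⟩ := x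
    exact congrArg _ (hKe _ rfl)

end

theorem mainTheorem10 (Γ : Type u) [Group Γ] [Countable Γ] (Λ : Type v) [Group Λ] [Countable Λ]
    (α : Γ →* MulAut Λ) :
    GroupHaagerupFromBelow (Λ ⋊[α] Γ) (SemidirectProduct.inl (φ := α)).range ↔
      (GroupVNA.action α).HaagerupFromBelow :=
  ⟨fun h => h.haagerupFromBelow, fun h => h.group⟩
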